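/- Corollary. For a Boolean algebra $\mathbb{B}$ let $\mathbb{B}^+=\mathbb{B}\setminus\{0\}$. The reaping number $\mathfrak{r}(\mathbb{B})$ of $\mathbb{B}$ (nontrivial) is the least cardinality of a set $Y\subseteq\mathbb{B}^+$ such that for every $b\in\mathbb{B}$ there is $r\in Y$ with $r\le b$ or $r\wedge b=0$. If $\mathbb{B}$ is atomless, the splitting number $\mathfrak{s}(\mathbb{B})$ is the least cardinality of a set $X\subseteq\mathbb{B}$ such that for every $r\in\mathbb{B}^+$ there is $b\in X$ with $r\not\le b$ and $r\wedge b\ne 0$. Write $\mathfrak{r}=\mathfrak{r}(\mathcal{P}(\omega)/\mathrm{fin})$ and $\mathfrak{s}=\mathfrak{s}(\mathcal{P}(\omega)/\mathrm{fin})$, where $\mathrm{fin}$ is the ideal of finite subsets of $\omega$. Let $\mathcal{M}$ be the ideal of meagre subsets of the Cantor space ${}^\omega 2$. Let $\mathrm{cof}(\mathcal{M})$ be the least cardinality of a family $\mathcal{C}\subseteq\mathcal{M}$ such that every member of $\mathcal{M}$ is contained in a member of $\mathcal{C}$, and let $\mathrm{add}(\mathcal{M})$ be the least cardinality of a family $\mathcal{F}\subseteq\mathcal{M}$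 with $\bigcup\mathcal{F}\notin\mathcal{M}$. Let $\mathbb{C}_\omega$ be the Cohen algebra, that is, the quotient of the Boolean algebra of Borel subsets of ${}^\omega 2$ by the ideal of meagre Borel sets, and let ${}^\omega\mathbb{C}_\omega/\mathrm{Fin}$ be its reduced power, that is, the quotient of the countable power ${}^\omega\mathbb{C}_\omega$ (with pointwise operations) by the ideal $\mathrm{Fin}=\{f : \{n<\omega : f(n)\neq 0\}\text{ is finite}\}$. Then $$\mathfrak{r}({}^\omega\mathbb{C}_\omega/\mathrm{Fin})=\mathfrak{r}+\mathrm{cof}(\mathcal{M})\qquad\text{and}\qquad\mathfrak{s}({}^\omega\mathbb{C}_\omega/\mathrm{Fin})=\min\{\mathfrak{s},\mathrm{add}(\mathcal{M})\}.$$ -/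

import Mathlib

open Cardinal

universe u v

/-! Quotients of Boolean algebras by ideals -/

/-- Two elements of a Boolean algebra are equivalent modulo the ideal `I` when their symmetric
difference belongs to `I`. -/
def idealSetoid {B : Type u} [BooleanAlgebra B] (I : Order.Ideal B) : Setoid B where
  r a b := symmDiff a b ∈ I
  iseqv :=
    { refl := fun a => by simp
      symm := fun {a b} h => by rwa [symmDiff_comm]
      trans := fun {a b c} h₁ h₂ =>
        I.lower (symmDiff_triangle a b c) (I.sup_mem h₁ h₂) }

/-- The quotient Boolean algebra `B / I`. -/
def BAQuotient (B : Type u) [BooleanAlgebra B] (I : Order.Ideal B) : Type u :=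
  Quotient (idealSetoid I)

namespace BAQuotient

variable {B : Type u} [BooleanAlgebra B] {I : Order.Ideal B}

/-- The equivalence class of an element. -/
def mk (I : Order.Ideal B) (a : B) : BAQuotient B I := Quotient.mk (idealSetoid I) a

theorem mk_eq_mk {a b : B} : mk I a = mk I b ↔ symmDiff a b ∈ I :=
  ⟨fun h => Quotient.exact h, fun h => Quotient.sound (s := idealSetoid I) h⟩

theorem symmDiff_mem_iff {a b : B} : symmDiff a b ∈ I ↔ a \ b ∈ I ∧ b \ a ∈ I := by
  rw [symmDiff, Order.Ideal.sup_mem_iff]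

theorem sdiff_mem_trans {a b c : B} (h₁ : a \ b ∈ I) (h₂ : b \ c ∈ I) : a \ c ∈ I :=
  I.lower (sdiff_triangle a b c) (I.sup_mem h₁ h₂)

theorem sup_sdiff_mem {a b a' b' : B} (h₁ : a \ a' ∈ I) (h₂ : b \ b' ∈ I) :
    (a ⊔ b) \ (a' ⊔ b') ∈ I := by
  refine I.lower ?_ (I.sup_mem h₁ h₂)
  rw [sup_sdiff]
  exact sup_le_sup (sdiff_le_sdiff_left le_sup_left) (sdiff_le_sdiff_left le_sup_right)

theorem inf_sdiff_mem {a b a' b' : B} (h₁ : a \ a' ∈ I) (h₂ : b \ b' ∈ I) :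
    (a ⊓ b) \ (a' ⊓ b') ∈ I := by
  refine I.lower ?_ (I.sup_mem h₁ h₂)
  rw [sdiff_inf]
  exact sup_le_sup (sdiff_le_sdiff_right inf_le_left) (sdiff_le_sdiff_right inf_le_right)

/-- The order of `B / I`: the class of `a` is below the class of `b` when `a \ b ∈ I`. -/
protected def le : BAQuotient B I → BAQuotient B I → Prop :=
  Quotient.lift₂ (s₁ := idealSetoid I) (s₂ := idealSetoid I) (fun a b => a \ b ∈ I) (by
    intro a b a' b' h₁ h₂
    have h₁' := symmDiff_mem_iff.1 h₁
    have h₂' := symmDiff_mem_iff.1 h₂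
    exact propext
      ⟨fun h => sdiff_mem_trans h₁'.2 (sdiff_mem_trans h h₂'.1),
        fun h => sdiff_mem_trans h₁'.1 (sdiff_mem_trans h h₂'.2)⟩)

/-- The binary supremum of `B / I`, computed on representatives. -/
protected def sup : BAQuotient B I → BAQuotient B I → BAQuotient B I :=
  Quotient.map₂ (sa := idealSetoid I) (sb := idealSetoid I) (sc := idealSetoid I)
    (· ⊔ ·) (by
      intro a a' h₁ b b' h₂
      have h₁' := symmDiff_mem_iff.1 h₁
      have h₂' := symmDiff_mem_iff.1 h₂
      exact symmDiff_mem_iff.2 ⟨sup_sdiff_mem h₁'.1 h₂'.1, sup_sdiff_mem h₁'.2 h₂'.2⟩)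

/-- The binary infimum of `B / I`, computed on representatives. -/
protected def inf : BAQuotient B I → BAQuotient B I → BAQuotient B I :=
  Quotient.map₂ (sa := idealSetoid I) (sb := idealSetoid I) (sc := idealSetoid I)
    (· ⊓ ·) (by
      intro a a' h₁ b b' h₂
      have h₁' := symmDiff_mem_iff.1 h₁
      have h₂' := symmDiff_mem_iff.1 h₂
      exact symmDiff_mem_iff.2 ⟨inf_sdiff_mem h₁'.1 h₂'.1, inf_sdiff_mem h₁'.2 h₂'.2⟩)

/-- The complement of `B / I`, computed on representatives. -/
protected def compl : BAQuotient B I → BAQuotient B I :=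
  Quotient.map (sa := idealSetoid I) (sb := idealSetoid I) (fun a => aᶜ) (by
    intro a b h
    change symmDiff aᶜ bᶜ ∈ I
    rw [compl_symmDiff_compl]
    exact h)

instance : BooleanAlgebra (BAQuotient B I) where
  le := BAQuotient.le
  sup := BAQuotient.sup
  inf := BAQuotient.inf
  compl := BAQuotient.compl
  top := mk I ⊤
  bot := mk I ⊥
  le_refl := by
    rintro ⟨a⟩
    change a \ a ∈ I
    simp
  le_trans := by
    rintro ⟨a⟩ ⟨b⟩ ⟨c⟩ h₁ h₂
    exact sdiff_mem_trans (I := I) h₁ h₂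
  le_antisymm := by
    rintro ⟨a⟩ ⟨b⟩ h₁ h₂
    exact mk_eq_mk.2 (symmDiff_mem_iff.2 ⟨h₁, h₂⟩)
  le_sup_left := by
    rintro ⟨a⟩ ⟨b⟩
    change a \ (a ⊔ b) ∈ I
    rw [sdiff_eq_bot_iff.2 le_sup_left]
    exact I.bot_mem
  le_sup_right := by
    rintro ⟨a⟩ ⟨b⟩
    change b \ (a ⊔ b) ∈ I
    rw [sdiff_eq_bot_iff.2 le_sup_right]
    exact I.bot_mem
  sup_le := by
    rintro ⟨a⟩ ⟨b⟩ ⟨c⟩ h₁ h₂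
    change (a ⊔ b) \ c ∈ I
    rw [sup_sdiff]
    exact I.sup_mem h₁ h₂
  inf_le_left := by
    rintro ⟨a⟩ ⟨b⟩
    change (a ⊓ b) \ a ∈ I
    rw [sdiff_eq_bot_iff.2 inf_le_left]
    exact I.bot_mem
  inf_le_right := by
    rintro ⟨a⟩ ⟨b⟩
    change (a ⊓ b) \ b ∈ I
    rw [sdiff_eq_bot_iff.2 inf_le_right]
    exact I.bot_mem
  le_inf := by
    rintro ⟨a⟩ ⟨b⟩ ⟨c⟩ h₁ h₂
    change a \ (b ⊓ c) ∈ I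
    rw [sdiff_inf]
    exact I.sup_mem h₁ h₂
  le_sup_inf := by
    rintro ⟨a⟩ ⟨b⟩ ⟨c⟩
    change ((a ⊔ b) ⊓ (a ⊔ c)) \ (a ⊔ b ⊓ c) ∈ I
    rw [sdiff_eq_bot_iff.2 le_sup_inf]
    exact I.bot_mem
  inf_compl_le_bot := by
    rintro ⟨a⟩
    change (a ⊓ aᶜ) \ ⊥ ∈ I
    simp
  top_le_sup_compl := by
    rintro ⟨a⟩
    change ⊤ \ (a ⊔ aᶜ) ∈ I
    simp
  le_top := by
    rintro ⟨a⟩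
    change a \ ⊤ ∈ I
    simp
  bot_le := by
    rintro ⟨a⟩
    change ⊥ \ a ∈ I
    simp

theorem mk_le_mk {a b : B} : mk I a ≤ mk I b ↔ a \ b ∈ I := Iff.rfl

theorem mk_sup_mk (a b : B) : mk I a ⊔ mk I b = mk I (a ⊔ b) := rfl

theorem mk_inf_mk (a b : B) : mk I a ⊓ mk I b = mk I (a ⊓ b) := rfl

theorem compl_mk (a : B) : (mk I a)ᶜ = mk I aᶜ := rfl

theorem mk_eq_bot {a : B} : mk I a = ⊥ ↔ a ∈ I := by
  change mk I a = mk I ⊥ ↔ _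
  rw [mk_eq_mk, symmDiff_bot]

theorem nontrivial_of_top_notMem (h : (⊤ : B) ∉ I) : Nontrivial (BAQuotient B I) :=
  ⟨⟨mk I ⊤, ⊥, fun h' => h (mk_eq_bot.1 h')⟩⟩

end BAQuotient

/-! The algebras -/

/-- The ideal of finite sets of natural numbers. -/
def finIdeal : Order.Ideal (Set ℕ) where
  carrier := {X | X.Finite}
  lower' := fun _ _ h hX => Set.Finite.subset hX h
  nonempty' := ⟨∅, Set.finite_empty⟩
  directed' := fun X hX Y hY => ⟨X ∪ Y, Set.Finite.union hX hY,
    Set.subset_union_left, Set.subset_union_right⟩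

/-- `𝒫(ω)/fin`. -/
abbrev PowFin : Type := BAQuotient (Set ℕ) finIdeal

/-- The ideal `Fin` of sequences in `B` with only finitely many nonzero entries. -/
def seqFinIdeal (B : Type u) [BooleanAlgebra B] : Order.Ideal (ℕ → B) where
  carrier := {f | {n | f n ≠ ⊥}.Finite}
  lower' := fun f g h hf => Set.Finite.subset hf fun n (hn : g n ≠ ⊥) hf0 =>
    hn (le_bot_iff.1 ((h n).trans hf0.le))
  nonempty' := ⟨⊥, by simp⟩
  directed' := fun f hf g hg => ⟨f ⊔ g,
    (Set.Finite.union hf hg).subset fun n (hn : f n ⊔ g n ≠ ⊥) => by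
      by_contra hc
      simp only [Set.mem_union, Set.mem_ofPred_eq, not_or, not_not] at hc
      exact hn (by rw [hc.1, hc.2, sup_bot_eq]),
    le_sup_left, le_sup_right⟩

/-- The reduced power `B^ω/Fin`. -/
abbrev ReducedPower (B : Type u) [BooleanAlgebra B] : Type u :=
  BAQuotient (ℕ → B) (seqFinIdeal B)

/-- The Cantor space `2^ω`, with the product topology and its Borel `σ`-algebra. -/
abbrev Cantor : Type := ℕ → Bool

/-- The measurable sets of the Cantor space are its Borel sets. -/
theorem cantor_borelSpace : BorelSpace Cantor := inferInstance

/-- The Boolean algebra of Borel subsets of the Cantor space. -/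
abbrev CantorBorel : Type := Subtype (MeasurableSet : Set Cantor → Prop)

/-- The ideal of meagre Borel subsets of the Cantor space. -/
def meagreIdeal : Order.Ideal CantorBorel where
  carrier := {X | IsMeagre (X : Set Cantor)}
  lower' := fun _ _ h hX => IsMeagre.mono h hX
  nonempty' := ⟨⊥, IsMeagre.empty⟩
  directed' := fun X hX Y hY => ⟨X ⊔ Y, IsMeagre.union hX hY, le_sup_left, le_sup_right⟩

/-- The Cohen algebra: Borel subsets of the Cantor space modulo meagre sets. -/
abbrev CohenAlgebra : Type := BAQuotient CantorBorel meagreIdeal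

/-! Relational systems and cardinal invariants -/

/-- A relational system `⟨A₋, A, A₊⟩`. -/
structure RelationalSystem where
  /-- The set of challenges. -/
  Neg : Type u
  /-- The set of responses. -/
  Pos : Type v
  /-- The relation. -/
  Rel : Neg → Pos → Prop

namespace RelationalSystem

/-- The cardinalities of the dominating subsets of `A₊`. -/
def dominatingCards (A : RelationalSystem.{u, v}) : Set Cardinal.{v} :=
  {κ | ∃ Y : Set A.Pos, (∀ x : A.Neg, ∃ y ∈ Y, A.Rel x y) ∧ #Y = κ}

/-- The cardinalities of the unbounded subsets of `A₋`. -/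
def unboundedCards (A : RelationalSystem.{u, v}) : Set Cardinal.{u} :=
  {κ | ∃ X : Set A.Neg, (∀ y : A.Pos, ∃ x ∈ X, ¬ A.Rel x y) ∧ #X = κ}

/-- The dominating number `𝔡(A)`. -/
noncomputable def dominatingNumber (A : RelationalSystem.{u, v}) : Cardinal.{v} :=
  sInf A.dominatingCards

/-- The bounding number `𝔟(A)`. -/
noncomputable def boundingNumber (A : RelationalSystem.{u, v}) : Cardinal.{u} :=
  sInf A.unboundedCards

theorem isLeast_dominatingNumber {A : RelationalSystem.{u, v}} (h : ∀ x, ∃ y, A.Rel x y) :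
    IsLeast A.dominatingCards A.dominatingNumber :=
  ⟨csInf_mem ⟨_, Set.univ, fun x => (h x).imp fun _ hy => ⟨Set.mem_univ _, hy⟩, rfl⟩,
    fun _ hκ => csInf_le' hκ⟩

theorem isLeast_boundingNumber {A : RelationalSystem.{u, v}} (h : ∀ y, ∃ x, ¬ A.Rel x y) :
    IsLeast A.unboundedCards A.boundingNumber :=
  ⟨csInf_mem ⟨_, Set.univ, fun y => (h y).imp fun _ hx => ⟨Set.mem_univ _, hx⟩, rfl⟩,
    fun _ hκ => csInf_le' hκ⟩

end RelationalSystem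

/-- The reaping relation `⟨B, R, B⁺⟩`, where `b R r` if and only if `r ≤ b` or `r ∧ b = 0`. -/
def reapingRelation (B : Type u) [BooleanAlgebra B] : RelationalSystem.{u, u} where
  Neg := B
  Pos := {r : B // r ≠ ⊥}
  Rel b r := r.1 ≤ b ∨ r.1 ⊓ b = ⊥

/-- The reaping number `𝔯(B)`. -/
noncomputable def reapingNumber (B : Type u) [BooleanAlgebra B] : Cardinal.{u} :=
  (reapingRelation B).dominatingNumber

/-- The splitting number `𝔰(B)`, meant for atomless `B`. -/
noncomputable def splittingNumber (B : Type u) [BooleanAlgebra B] : Cardinal.{u} :=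
  (reapingRelation B).boundingNumber

/-- The cardinalities of the cofinal subfamilies of the meagre ideal of the Cantor space. -/
def meagreCofinalCards : Set Cardinal.{0} :=
  {κ | ∃ C : Set (Set Cantor), (∀ Y ∈ C, IsMeagre Y) ∧
    (∀ X : Set Cantor, IsMeagre X → ∃ Y ∈ C, X ⊆ Y) ∧ #C = κ}

/-- The cardinalities of the families of meagre subsets of the Cantor space whose union is not
meagre. -/
def meagreNonadditiveCards : Set Cardinal.{0} :=
  {κ | ∃ F : Set (Set Cantor), (∀ X ∈ F, IsMeagre X) ∧ ¬ IsMeagre (⋃₀ F) ∧ #F = κ}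

/-- `cof(ℳ)`. -/
noncomputable def cofMeagre : Cardinal.{0} := sInf meagreCofinalCards

/-- `add(ℳ)`. -/
noncomputable def addMeagre : Cardinal.{0} := sInf meagreNonadditiveCards

/-! All the minima above are minima of nonempty sets of cardinals. -/

theorem isLeast_reapingNumber (B : Type u) [BooleanAlgebra B] [Nontrivial B] :
    IsLeast (reapingRelation B).dominatingCards (reapingNumber B) := by
  refine RelationalSystem.isLeast_dominatingNumber fun (b : B) => ?_
  by_cases hb : b = ⊥
  · exact ⟨⟨⊤, top_ne_bot⟩, Or.inr (by simp [hb])⟩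
  · exact ⟨⟨b, hb⟩, Or.inl le_rfl⟩

theorem isLeast_splittingNumber (B : Type u) [BooleanAlgebra B] (h : ∀ a : B, ¬ IsAtom a) :
    IsLeast (reapingRelation B).unboundedCards (splittingNumber B) := by
  refine RelationalSystem.isLeast_boundingNumber fun r => ?_
  obtain ⟨r, hr⟩ := r
  have h' := h r
  simp only [IsAtom, not_and, not_forall] at h'
  obtain ⟨b, hb, hb0⟩ := h' hr
  refine ⟨b, ?_⟩
  rintro (h1 | h1)
  · exact absurd h1 (not_le_of_gt hb)
  · exact hb0 (by rw [← h1]; exact (inf_eq_right.2 hb.le).symm)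

/-- An infinite set of natural numbers has an infinite subset with infinite complement in it. -/
theorem exists_infinite_split {X : Set ℕ} (hX : X.Infinite) :
    ∃ Y ⊆ X, Y.Infinite ∧ (X \ Y).Infinite := by
  have := hX.to_subtype
  classical
  let e := Nat.orderEmbeddingOfSet X 
  have he : ∀ n, e n ∈ X := fun n => Nat.orderEmbeddingOfSet_range X ▸ Set.mem_range_self n
  refine ⟨Set.range fun n => e (2 * n), ?_, ?_, ?_⟩
  · rintro _ ⟨n, rfl⟩
    exact he _
  · refine Set.infinite_range_of_injective fun m n h => ?_
    have := e.injective h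
    omega
  · have : (Set.range fun n => e (2 * n + 1)).Infinite :=
      Set.infinite_range_of_injective fun m n h => by
        have := e.injective h
        omega
    refine this.mono ?_
    rintro _ ⟨n, rfl⟩
    refine ⟨he _, ?_⟩
    rintro ⟨m, hm⟩
    have := e.injective hm
    omega

instance : Nontrivial PowFin :=
  BAQuotient.nontrivial_of_top_notMem fun h => Set.infinite_univ (α := ℕ) h

theorem powFin_atomless (a : PowFin) : ¬ IsAtom a := by
  obtain ⟨X, rfl⟩ := Quotient.exists_rep a
  change ¬ IsAtom (BAQuotient.mk finIdeal X)
  rintro ⟨h0, h⟩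
  obtain ⟨Y, hYX, hY, hXY⟩ := exists_infinite_split (X := X) fun hf => h0 (BAQuotient.mk_eq_bot.2 hf)
  refine hY (BAQuotient.mk_eq_bot.1 (h (BAQuotient.mk finIdeal Y) (lt_of_le_not_ge ?_ ?_)))
  · rw [BAQuotient.mk_le_mk, sdiff_eq_bot_iff.2 hYX]
    exact finIdeal.bot_mem
  · exact fun hle => hXY (BAQuotient.mk_le_mk.1 hle)

instance (B : Type u) [BooleanAlgebra B] [Nontrivial B] : Nontrivial (ReducedPower B) := by
  refine BAQuotient.nontrivial_of_top_notMem fun h => Set.infinite_univ (α := ℕ) ?_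
  refine Set.Finite.subset h fun n _ => ?_
  exact (top_ne_bot : (⊤ : B) ≠ ⊥)

theorem reducedPower_atomless (B : Type u) [BooleanAlgebra B] (a : ReducedPower B) :
    ¬ IsAtom a := by
  classical
  obtain ⟨f, rfl⟩ := Quotient.exists_rep a
  change ¬ IsAtom (BAQuotient.mk (seqFinIdeal B) f)
  rintro ⟨h0, h⟩
  obtain ⟨Y, hYX, hY, hXY⟩ := exists_infinite_split (X := {n | f n ≠ ⊥})
    fun hf => h0 (BAQuotient.mk_eq_bot.2 hf)
  let g : ℕ → B := fun n => if n ∈ Y then f n else ⊥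
  have hgf : g ≤ f := fun n => by
    by_cases hn : n ∈ Y <;> simp [g, hn]
  refine hY (Set.Finite.subset (BAQuotient.mk_eq_bot.1
    (h (BAQuotient.mk (seqFinIdeal B) g) (lt_of_le_not_ge ?_ ?_))) fun n hn => ?_)
  · rw [BAQuotient.mk_le_mk, sdiff_eq_bot_iff.2 hgf]
    exact (seqFinIdeal B).bot_mem
  · refine fun hle => hXY (Set.Finite.subset (BAQuotient.mk_le_mk.1 hle) fun n hn => ?_)
    change f n \ g n ≠ ⊥
    simpa [g, hn.2] using hn.1
  · change g n ≠ ⊥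
    simpa [g, hn] using hYX hn

theorem not_isMeagre_univ_cantor : ¬ IsMeagre (Set.univ : Set Cantor) := by
  intro h
  rw [IsMeagre, Set.compl_univ] at h
  exact (dense_of_mem_residual h).nonempty.ne_empty rfl

instance : Nontrivial CohenAlgebra :=
  BAQuotient.nontrivial_of_top_notMem not_isMeagre_univ_cantor

theorem isLeast_cofMeagre : IsLeast meagreCofinalCards cofMeagre :=
  ⟨csInf_mem ⟨_, {X | IsMeagre X}, fun _ h => h, fun X hX => ⟨X, hX, le_rfl⟩, rfl⟩,
    fun _ hκ => csInf_le' hκ⟩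

theorem isLeast_addMeagre : IsLeast meagreNonadditiveCards addMeagre := by
  refine ⟨csInf_mem ⟨_, Set.range fun x : Cantor => ({x} : Set Cantor), ?_, ?_, rfl⟩,
    fun _ hκ => csInf_le' hκ⟩
  · rintro _ ⟨x, rfl⟩
    have : Filter.NeBot (nhdsWithin x {x}ᶜ) := by
      refine mem_closure_iff_nhdsWithin_neBot.1 (mem_closure_of_tendsto
        (f := fun n : ℕ => Function.update x n (!x n)) (b := Filter.atTop) ?_
        (Filter.Eventually.of_forall fun n h => ?_))
      · refine tendsto_pi_nhds.2 fun k => tendsto_const_nhds.congr' ?_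
        filter_upwards [Filter.eventually_gt_atTop k] with n hn
        exact (Function.update_of_ne hn.ne _ _).symm
      · have := congrFun (Set.mem_singleton_iff.1 h) n
        simp at this
    exact IsNowhereDense.isMeagre (isClosed_singleton.isNowhereDense_iff.2 (interior_singleton x))
  · have : ⋃₀ (Set.range fun x : Cantor => ({x} : Set Cantor)) = Set.univ := by
      ext x; simp
    rw [this]
    exact not_isMeagre_univ_cantor

/-!
Everything reduces to Galois–Tukey connections between three relational systems: reaping in
`𝒫(ω)/fin`, reaping in the reduced power `C^ω/Fin` of the Cohen algebra `C`, and the meagre ideal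
`ℳ` ordered by inclusion. Such a connection compares the dominating numbers (`𝔯` and `cof(ℳ)`) in
one direction and the bounding numbers (`𝔰` and `add(ℳ)`) in the other.

Meagre sets are handled through chopped reals: for a real `x` and a partition of `ω` into blocks
`[l k, l (k + 1))`, the set `matchFinite x l` of all reals that agree with `x` on only finitely many
blocks is meagre, and these sets are cofinal in `ℳ` (`IsMeagre.exists_subset_matchFinite`). More
generally, for any sequence of dense open subsets of the forcing `2^{<ω}` there is a chopped real
such that matching it on a block means entering all the dense sets with index up to the left end of
the block (`IsDenseFamily.exists_chopped`).

*Upper bound for `𝔯(C^ω/Fin)`.* A sequence `b` in `C` gives dense sets of conditions deciding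
`b n`, hence a chopped real `(x', l')`. If `matchFinite x' l' ⊆ matchFinite x l`, then almost every
even-numbered block of `l` contains a block of `l'` on which `x` agrees with `x'`
(`eventually_exists_block_of_matchFinite_subset`), so the cylinder of `x` up to the end of the
`2 n`-th block decides `b n` for almost all `n`. It remains to reap the set of the `n` for which the
decision is positive. This is a composition of `ℳ` with reaping in `𝒫(ω)/fin`
(`exists_tukey_reducedPower_meagre_powFin`), and compositions are governed by
`RelationalSystem.dominatingNumber_le_mul` and `RelationalSystem.min_boundingNumber_le`.

*Lower bound by `cof(ℳ)`.* A chopped real `(x, l)` gives the sequence of open sets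
`firstMatch x l n true`: find the first block from the `n`-th on where `x` is matched, and look at
the next bit. A cylinder that decides this element must already contain such a block
(`exists_block_of_cylinderClass_decides`). As cylinders are dense in `C`, a nonzero element `r` of
the reduced power has cylinders with stems `z n` of length `m n` below infinitely many of its
entries; if `r` reaps the sequence, then almost every `z n` matches `x` on a block inside
`[n, m n)`. The set of the reals that disagree with `z n` somewhere on `[n, m n)` for almost all `n`
is meagre, depends only on `r`, and contains `matchFinite x l`
(`exists_tukey_meagre_reducedPower`).

The lower bound by `𝔯` comes from the characteristic sequences of subsets of `ω`
(`exists_tukey_powFin_reducedPower`). Since `cof(ℳ)` is infinite, the product bound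
`cof(ℳ) · 𝔯` is at most the sum.
-/

/-! ### Galois–Tukey connections -/

namespace RelationalSystem

theorem exists_dominating_of_lt_boundingNumber {A : RelationalSystem.{u, v}} {X : Set A.Neg}
    (hX : #X < A.boundingNumber) : ∃ y, ∀ x ∈ X, A.Rel x y := by
  by_contra! h
  exact notMem_of_lt_csInf' hX ⟨X, h, rfl⟩

theorem dominatingNumber_le {A : RelationalSystem.{u, v}} {Y : Set A.Pos}
    (hY : ∀ x, ∃ y ∈ Y, A.Rel x y) : A.dominatingNumber ≤ #Y :=
  csInf_le' ⟨Y, hY, rfl⟩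

theorem boundingNumber_le {A : RelationalSystem.{u, v}} {X : Set A.Neg}
    (hX : ∀ y, ∃ x ∈ X, ¬ A.Rel x y) : A.boundingNumber ≤ #X :=
  csInf_le' ⟨X, hX, rfl⟩

theorem dominatingNumber_le_of_tukey {A B : RelationalSystem.{u, v}} (φ : A.Neg → B.Neg)
    (ψ : B.Pos → A.Pos) (h : ∀ x y, B.Rel (φ x) y → A.Rel x (ψ y))
    (hB : B.dominatingCards.Nonempty) : A.dominatingNumber ≤ B.dominatingNumber := by
  obtain ⟨Y, hY, hc⟩ := csInf_mem hB
  refine (dominatingNumber_le (Y := ψ '' Y) fun x => ?_).trans (mk_image_le.trans hc.le)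
  obtain ⟨y, hy, hxy⟩ := hY (φ x)
  exact ⟨ψ y, ⟨y, hy, rfl⟩, h x y hxy⟩

theorem boundingNumber_le_of_tukey {A B : RelationalSystem.{u, v}} (φ : A.Neg → B.Neg)
    (ψ : B.Pos → A.Pos) (h : ∀ x y, B.Rel (φ x) y → A.Rel x (ψ y))
    (hA : A.unboundedCards.Nonempty) : B.boundingNumber ≤ A.boundingNumber := by
  obtain ⟨X, hX, hc⟩ := csInf_mem hA
  refine (boundingNumber_le (X := φ '' X) fun y => ?_).trans (mk_image_le.trans hc.le)
  obtain ⟨x, hx, hxy⟩ := hX (ψ y)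
  exact ⟨φ x, ⟨x, hx, rfl⟩, fun hr => hxy (h x y hr)⟩

/-- If a challenge to `A` can be met by first meeting a challenge to `B` and then one to `C`, where
the second challenge may depend on the response to the first, then `𝔡(A) ≤ 𝔡(B) · 𝔡(C)`. -/
theorem dominatingNumber_le_mul {A B C : RelationalSystem.{u, v}} (φ : A.Neg → B.Neg)
    (χ : A.Neg → B.Pos → C.Neg) (ψ : B.Pos → C.Pos → A.Pos)
    (h : ∀ x y z, B.Rel (φ x) y → C.Rel (χ x y) z → A.Rel x (ψ y z))
    (hB : B.dominatingCards.Nonempty) (hC : C.dominatingCards.Nonempty) :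
    A.dominatingNumber ≤ B.dominatingNumber * C.dominatingNumber := by
  obtain ⟨Y, hY, hYc⟩ := csInf_mem hB
  obtain ⟨Z, hZ, hZc⟩ := csInf_mem hC
  refine (dominatingNumber_le (Y := Set.range fun p : Y × Z => ψ p.1 p.2) fun x => ?_).trans
    (mk_range_le.trans ?_)
  · obtain ⟨y, hy, hxy⟩ := hY (φ x)
    obtain ⟨z, hz, hxz⟩ := hZ (χ x y)
    exact ⟨_, ⟨(⟨y, hy⟩, ⟨z, hz⟩), rfl⟩, h x y z hxy hxz⟩
  · rw [mk_prod, lift_id, lift_id, hYc, hZc]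
    rfl

/-- The dual of `dominatingNumber_le_mul`. -/
theorem min_boundingNumber_le {A B C : RelationalSystem.{u, v}} (φ : A.Neg → B.Neg)
    (χ : A.Neg → B.Pos → C.Neg) (ψ : B.Pos → C.Pos → A.Pos)
    (h : ∀ x y z, B.Rel (φ x) y → C.Rel (χ x y) z → A.Rel x (ψ y z))
    (hA : A.unboundedCards.Nonempty) :
    min B.boundingNumber C.boundingNumber ≤ A.boundingNumber := by
  obtain ⟨X, hX, hc⟩ := csInf_mem hA
  change _ ≤ sInf _
  rw [← hc]
  by_contra! hlt
  obtain ⟨h₁, h₂⟩ := lt_min_iff.1 hlt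
  obtain ⟨y, hy⟩ := exists_dominating_of_lt_boundingNumber (X := φ '' X) (mk_image_le.trans_lt h₁)
  obtain ⟨z, hz⟩ := exists_dominating_of_lt_boundingNumber (X := (fun x => χ x y) '' X)
    (mk_image_le.trans_lt h₂)
  obtain ⟨x, hx, hxyz⟩ := hX (ψ y z)
  exact hxyz (h x y z (hy _ ⟨x, hx, rfl⟩) (hz _ ⟨x, hx, rfl⟩))

end RelationalSystem

/-- The meagre ideal of the Cantor space ordered by inclusion, as a relational system. -/
def meagreRelation : RelationalSystem.{0, 0} where
  Neg := {X : Set Cantor // IsMeagre X}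
  Pos := {X : Set Cantor // IsMeagre X}
  Rel X Y := X.1 ⊆ Y.1

theorem meagreRelation_dominatingCards : meagreRelation.dominatingCards = meagreCofinalCards := by
  ext κ
  constructor
  · rintro ⟨Y, hY, rfl⟩
    refine ⟨Subtype.val '' Y, ?_, fun X hX => ?_, mk_image_eq Subtype.val_injective⟩
    · rintro _ ⟨y, -, rfl⟩
      exact y.2
    · obtain ⟨y, hy, hXy⟩ := hY ⟨X, hX⟩
      exact ⟨y.1, ⟨y, hy, rfl⟩, hXy⟩
  · rintro ⟨C, hC, h, rfl⟩
    refine ⟨Set.range fun Y : C => ⟨Y.1, hC Y.1 Y.2⟩, fun X => ?_, mk_range_eq _ ?_⟩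
    · obtain ⟨Y, hY, hXY⟩ := h X.1 X.2
      exact ⟨_, ⟨⟨Y, hY⟩, rfl⟩, hXY⟩
    · intro Y Y' h
      exact Subtype.ext (congrArg (fun Z : {X : Set Cantor // IsMeagre X} => Z.1) h)

theorem meagreRelation_unboundedCards :
    meagreRelation.unboundedCards = meagreNonadditiveCards := by
  ext κ
  constructor
  · rintro ⟨X, hX, rfl⟩
    refine ⟨Subtype.val '' X, ?_, fun hU => ?_, mk_image_eq Subtype.val_injective⟩
    · rintro _ ⟨x, -, rfl⟩
      exact x.2
    · obtain ⟨x, hx, hxU⟩ := hX ⟨_, hU⟩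
      exact hxU (Set.subset_sUnion_of_mem ⟨x, hx, rfl⟩)
  · rintro ⟨F, hF, h, rfl⟩
    refine ⟨Set.range fun Y : F => ⟨Y.1, hF Y.1 Y.2⟩, fun Y => ?_, mk_range_eq _ ?_⟩
    · by_contra! hc
      exact h (Y.2.mono (Set.sUnion_subset fun X hX => hc _ ⟨⟨X, hX⟩, rfl⟩))
    · intro Y Y' h
      exact Subtype.ext (congrArg (fun Z : {X : Set Cantor // IsMeagre X} => Z.1) h)

theorem meagreRelation_dominatingNumber : meagreRelation.dominatingNumber = cofMeagre :=
  congrArg sInf meagreRelation_dominatingCards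

theorem meagreRelation_boundingNumber : meagreRelation.boundingNumber = addMeagre :=
  congrArg sInf meagreRelation_unboundedCards

theorem isMeagre_singleton_cantor (x : Cantor) : IsMeagre ({x} : Set Cantor) := by
  refine IsNowhereDense.isMeagre (isClosed_singleton.isNowhereDense_iff.2 ?_)
  have : (nhdsWithin x {x}ᶜ).NeBot := by
    refine mem_closure_iff_nhdsWithin_neBot.1 (mem_closure_of_tendsto
      (f := fun n : ℕ => Function.update x n (!x n)) (b := Filter.atTop)
      (tendsto_pi_nhds.2 fun k => tendsto_const_nhds.congr' ?_)
      (Filter.Eventually.of_forall fun n h => ?_))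
    · filter_upwards [Filter.eventually_gt_atTop k] with n hn
      exact (Function.update_of_ne hn.ne _ _).symm
    · simpa using congrFun (Set.mem_singleton_iff.1 h) n
  exact interior_singleton x

theorem aleph0_le_cofMeagre : ℵ₀ ≤ cofMeagre := by
  obtain ⟨C, hC, h, hc⟩ := isLeast_cofMeagre.1
  rw [← hc]
  by_contra! hlt
  have hfin : C.Finite := lt_aleph0_iff_set_finite.1 hlt
  refine not_isMeagre_univ_cantor (IsMeagre.mono (s := ⋃ Y ∈ C, Y) (fun x _ => ?_)
    (isMeagre_biUnion hfin.countable hC))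
  obtain ⟨Y, hY, hx⟩ := h _ (isMeagre_singleton_cantor x)
  exact Set.mem_biUnion hY (hx rfl)

section

open Set Filter PiNat BAQuotient

/-! ### Matching reals on blocks of coordinates -/

theorem isOpen_of_forall_cylinder_subset {S : Set Cantor}
    (h : ∀ y ∈ S, ∃ n, cylinder y n ⊆ S) : IsOpen S := by
  refine isOpen_iff_forall_mem_open.2 fun y hy => ?_
  obtain ⟨n, hn⟩ := h y hy
  exact ⟨_, hn, isOpen_cylinder _ y n, self_mem_cylinder y n⟩

theorem exists_cylinder_subset {U : Set Cantor} (hU : IsOpen U) {x : Cantor} (hx : x ∈ U) :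
    ∃ n, cylinder x n ⊆ U := by
  obtain ⟨_, ⟨y, n, rfl⟩, hxy, hU⟩ :=
    (isTopologicalBasis_cylinders fun _ : ℕ => Bool).exists_subset_of_mem_open hx hU
  exact ⟨n, (mem_cylinder_iff_eq.1 hxy).symm ▸ hU⟩

/-- The sequences that, for all but finitely many `n`, differ from `x n` somewhere on the block
`[a n, b n)`. -/
def avoidSet (a b : ℕ → ℕ) (x : ℕ → Cantor) : Set Cantor :=
  {y | ∀ᶠ n in atTop, ∃ i ∈ Ico (a n) (b n), y i ≠ x n i}

theorem isMeagre_avoidSet {a : ℕ → ℕ} (ha : ∀ n, n ≤ a n) (b : ℕ → ℕ) (x : ℕ → Cantor) :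
    IsMeagre (avoidSet a b x) := by
  have hF : avoidSet a b x = ⋃ N, {y | ∀ n ≥ N, ∃ i ∈ Ico (a n) (b n), y i ≠ x n i} := by
    ext y
    simp [avoidSet, eventually_atTop]
  rw [hF]
  refine isMeagre_iUnion fun N => IsNowhereDense.isMeagre ?_
  set F := {y : Cantor | ∀ n ≥ N, ∃ i ∈ Ico (a n) (b n), y i ≠ x n i} with hFdef
  have hc : IsClosed F := by
    rw [← isOpen_compl_iff]
    refine isOpen_of_forall_cylinder_subset fun y hy => ?_
    simp only [hFdef, mem_compl_iff, mem_ofPred_eq, not_forall, not_exists, not_and, not_not] at hy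
    obtain ⟨n, hn, h⟩ := hy
    refine ⟨b n, fun z hz hzF => ?_⟩
    obtain ⟨i, hi, hne⟩ := hzF n hn
    exact hne ((mem_cylinder_iff.1 hz i hi.2).trans (h i hi))
  rw [hc.isNowhereDense_iff, eq_empty_iff_forall_notMem]
  intro y hy
  obtain ⟨m, hm⟩ := exists_cylinder_subset isOpen_interior hy
  -- Any cylinder contains a sequence that agrees with `x n` on `[a n, b n)`, for `n` so large that
  -- this block lies beyond the stem of the cylinder.
  let n := max N m
  let z : Cantor := fun i => if i < m then y i else x n i
  have hz : z ∈ F := interior_subset (hm (mem_cylinder_iff.2 fun i hi => if_pos hi))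
  obtain ⟨i, hi, hne⟩ := hz n (le_max_left _ _)
  have : ¬ i < m := not_lt.2 ((le_max_right N m).trans ((ha n).trans hi.1))
  exact hne (if_neg this)

/-- A family of subsets of the Cantor space that corresponds to a dense open subset of the
forcing `2^{<ω}`: it is closed under subsets, and every cylinder contains a cylinder from it. -/
structure IsDenseFamily (D : Set (Set Cantor)) : Prop where
  isLowerSet : IsLowerSet D
  exists_cylinder_mem : ∀ x m, ∃ y ∈ cylinder x m, ∃ n, cylinder y n ∈ D

namespace IsDenseFamily

theorem exists_cylinder_mem_ge {D : Set (Set Cantor)} (hD : IsDenseFamily D) (x : Cantor)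
    (m : ℕ) : ∃ y ∈ cylinder x m, ∃ n ≥ m, cylinder y n ∈ D := by
  obtain ⟨y, hy, n, hn⟩ := hD.exists_cylinder_mem x m
  exact ⟨y, hy, max n m, le_max_right _ _,
    hD.isLowerSet (cylinder_anti y (le_max_left n m)) hn⟩

theorem inter {D E : Set (Set Cantor)} (hD : IsDenseFamily D) (hE : IsDenseFamily E) :
    IsDenseFamily (D ∩ E) where
  isLowerSet := hD.isLowerSet.inter hE.isLowerSet
  exists_cylinder_mem x m := by
    obtain ⟨y, hy, n, hmn, hn⟩ := hD.exists_cylinder_mem_ge x m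
    obtain ⟨z, hz, k, hnk, hk⟩ := hE.exists_cylinder_mem_ge y n
    have hzy : cylinder z k ⊆ cylinder y n :=
      mem_cylinder_iff_eq.1 hz ▸ cylinder_anti z hnk
    refine ⟨z, ?_, k, hD.isLowerSet hzy hn, hk⟩
    exact mem_cylinder_iff_eq.1 hy ▸ cylinder_anti y hmn hz

theorem biInter_le {D : ℕ → Set (Set Cantor)} (hD : ∀ i, IsDenseFamily (D i)) (m : ℕ) :
    IsDenseFamily (⋂ i ≤ m, D i) := by
  induction m with
  | zero => simpa using hD 0
  | succ m ih =>
    have : ⋂ i ≤ m + 1, D i = (⋂ i ≤ m, D i) ∩ D (m + 1) := by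
      ext W
      simp only [mem_iInter, mem_inter_iff]
      exact ⟨fun h => ⟨fun i hi => h i (by lia), h _ le_rfl⟩, fun h i hi => by
        obtain hi | rfl := Nat.le_succ_iff.1 hi
        exacts [h.1 i hi, h.2]⟩
    rw [this]
    exact ih.inter (hD _)

/-- A finite string, written on the coordinates from `m` on, that leads into `D` no matter which
of the finitely many strings of length `m` precedes it. -/
theorem exists_block {D : Set (Set Cantor)} (hD : IsDenseFamily D) (m : ℕ) :
    ∃ n > m, ∃ x : Cantor, ∀ z, (∀ i ∈ Ico m n, z i = x i) → cylinder z n ∈ D := by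
  suffices h : ∀ S : Set (Fin m → Bool), S.Finite → ∃ n > m, ∃ x : Cantor, ∀ z : Cantor,
      (fun i : Fin m => z i) ∈ S → (∀ i ∈ Ico m n, z i = x i) → cylinder z n ∈ D by
    obtain ⟨n, hn, x, hx⟩ := h univ finite_univ
    exact ⟨n, hn, x, fun z => hx z (mem_univ _)⟩
  intro S hS
  induction S, hS using Set.Finite.induction_on with
  | empty => exact ⟨m + 1, m.lt_succ_self, fun _ => false, fun z hz => hz.elim⟩
  | @insert u S _ _ ih =>
    obtain ⟨n, hn, x, hx⟩ := ih
    obtain ⟨y, hy, k, hnk, hk⟩ := hD.exists_cylinder_mem_ge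
      (fun i => if h : i < m then u ⟨i, h⟩ else x i) n
    rw [mem_cylinder_iff] at hy
    refine ⟨k, hn.trans_le hnk, y, fun z hzS hz => ?_⟩
    rcases hzS with rfl | hzS
    · have : z ∈ cylinder y k := mem_cylinder_iff.2 fun i hi => by
        by_cases him : i < m
        · rw [hy i (him.trans hn), dif_pos him]
        · exact hz i ⟨not_lt.1 him, hi⟩
      rwa [mem_cylinder_iff_eq.1 this]
    · refine hD.isLowerSet (cylinder_anti z hnk) (hx z hzS fun i hi => ?_)
      rw [hz i ⟨hi.1, hi.2.trans_le hnk⟩, hy i hi.2, dif_neg (not_lt.2 hi.1)]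

/-- Countably many dense families are captured by a single real `x` chopped into blocks: matching
`x` on a block forces a cylinder into all the families whose index is at most the left endpoint of
the block. -/
theorem exists_chopped {D : ℕ → Set (Set Cantor)} (hD : ∀ i, IsDenseFamily (D i)) :
    ∃ (x : Cantor) (l : ℕ → ℕ), StrictMono l ∧ ∀ k z,
      (∀ i ∈ Ico (l k) (l (k + 1)), z i = x i) → ∀ i ≤ l k, cylinder z (l (k + 1)) ∈ D i := by
  choose f hf X hX using fun m => (biInter_le hD m).exists_block m
  let l : ℕ → ℕ := fun k => f^[k] 0
  have hl : ∀ k, l (k + 1) = f (l k) := fun k => Function.iterate_succ_apply' f k 0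
  have hmono : StrictMono l := strictMono_nat_of_lt_succ fun k => (hl k).symm ▸ hf (l k)
  -- The coordinate `i` lies in the block whose index is the largest `k` with `l k ≤ i`.
  refine ⟨fun i => X (l (Nat.findGreatest (fun k => l k ≤ i) i)) i, l, hmono, fun k z hz i hi => ?_⟩
  have := hX (l k) z fun j hj => ?_
  · rw [hl]
    exact mem_iInter₂.1 this i hi
  · rw [← hl] at hj
    have hk : Nat.findGreatest (fun k => l k ≤ j) j = k := by
      rw [Nat.findGreatest_eq_iff]
      exact ⟨hmono.le_apply.trans hj.1, fun _ => hj.1, fun n hn _ =>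
        not_le.2 (hj.2.trans_le (hmono.monotone hn))⟩
    rw [hz j hj]
    exact congrArg (fun q => X (l q) j) hk

end IsDenseFamily

/-- The sequences that match `x` on only finitely many of the blocks `[l k, l (k + 1))`. -/
abbrev matchFinite (x : Cantor) (l : ℕ → ℕ) : Set Cantor :=
  avoidSet l (fun k => l (k + 1)) fun _ => x

theorem isDenseFamily_disjoint {F : Set Cantor} (hF : IsNowhereDense F) :
    IsDenseFamily {W | Disjoint W F} where
  isLowerSet _ _ h hV := Disjoint.mono_left h hV
  exists_cylinder_mem x m := by
    obtain ⟨y, hy⟩ : (cylinder x m \ closure F).Nonempty := by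
      rw [nonempty_iff_ne_empty, Ne, sdiff_eq_empty]
      intro h
      have := interior_maximal h (isOpen_cylinder _ x m) (self_mem_cylinder x m)
      rw [hF] at this
      exact this
    obtain ⟨n, hn⟩ := exists_cylinder_subset isClosed_closure.isOpen_compl hy.2
    exact ⟨y, hy.1, n, (disjoint_compl_left.mono_left hn).mono_right subset_closure⟩

/-- The sets `matchFinite x l` are cofinal in the meagre ideal. -/
theorem IsMeagre.exists_subset_matchFinite {Y : Set Cantor} (hY : IsMeagre Y) :
    ∃ (x : Cantor) (l : ℕ → ℕ), StrictMono l ∧ Y ⊆ matchFinite x l := by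
  obtain ⟨S, hS, hc, hYS⟩ := isMeagre_iff_countable_union_isNowhereDense.1 hY
  obtain ⟨F, hF⟩ : ∃ F : ℕ → Set Cantor, insert ∅ S = range F :=
    (hc.insert ∅).exists_eq_range (insert_nonempty _ _)
  have hF' : ∀ i, IsNowhereDense (F i) := fun i => by
    rcases (hF ▸ mem_range_self i : F i ∈ insert ∅ S) with h | h
    · rw [h]
      exact isNowhereDense_empty
    · exact hS _ h
  obtain ⟨x, l, hl, h⟩ := IsDenseFamily.exists_chopped fun i => isDenseFamily_disjoint (hF' i)
  refine ⟨x, l, hl, fun y hy => ?_⟩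
  obtain ⟨t, ht, hyt⟩ := hYS hy
  obtain ⟨n, rfl⟩ : t ∈ range F := hF ▸ mem_insert_of_mem _ ht
  filter_upwards [eventually_ge_atTop n] with k hk
  by_contra! hc
  exact disjoint_left.1 (h k y hc n (hk.trans hl.le_apply)) (self_mem_cylinder y _) hyt

/-- If the meagre set given by `x'` and `l'` is contained in the one given by `x` and `l`, then
almost every even-numbered block of `l` contains a block of `l'` on which `x` agrees with `x'`.
The odd-numbered blocks serve to keep the even ones apart. -/
theorem eventually_exists_block_of_matchFinite_subset {x x' : Cantor} {l l' : ℕ → ℕ}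
    (hl : StrictMono l) (hl' : StrictMono l') (h : matchFinite x' l' ⊆ matchFinite x l) :
    ∀ᶠ n in atTop, ∃ k, l (2 * n) ≤ l' k ∧ l' (k + 1) ≤ l (2 * n + 1) ∧
      ∀ i ∈ Ico (l' k) (l' (k + 1)), x i = x' i := by
  classical
  by_contra hcon
  rw [not_eventually] at hcon
  let N : Set ℕ := {n | ¬ ∃ k, l (2 * n) ≤ l' k ∧ l' (k + 1) ≤ l (2 * n + 1) ∧
    ∀ i ∈ Ico (l' k) (l' (k + 1)), x i = x' i}
  -- This sequence matches `x` on the bad blocks, and differs from `x'` everywhere else.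
  let y : Cantor := fun i =>
    if ∃ n ∈ N, i ∈ Ico (l (2 * n)) (l (2 * n + 1)) then x i else !x' i
  have hy : y ∈ matchFinite x' l' := by
    refine Eventually.of_forall fun k => ?_
    by_contra! hk
    have hmem : ∀ i ∈ Ico (l' k) (l' (k + 1)), ∃ n ∈ N, i ∈ Ico (l (2 * n)) (l (2 * n + 1)) := by
      intro i hi
      by_contra hc
      have := hk i hi
      simp only [y, if_neg hc] at this
      exact Bool.not_ne_self _ this
    have hlt : l' k < l' (k + 1) := hl' k.lt_succ_self
    obtain ⟨n, hn, h₁, h₂⟩ := hmem (l' k) ⟨le_rfl, hlt⟩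
    refine hn ⟨k, h₁, ?_, fun i hi => ?_⟩
    · -- Otherwise the block of `l'` contains the first element of an odd-numbered block of `l`.
      by_contra! hc
      obtain ⟨p, -, h₃, h₄⟩ := hmem (l (2 * n + 1)) ⟨h₂.le, hc⟩
      have := hl.le_iff_le.1 h₃
      have := hl.lt_iff_lt.1 h₄
      lia
    · have := hk i hi
      simp only [y, if_pos (hmem i hi)] at this
      exact this
  have hfreq : ∃ᶠ n in atTop, n ∈ N := hcon
  obtain ⟨K, hK⟩ := eventually_atTop.1 (h hy)
  obtain ⟨n, hn, hnN⟩ := frequently_atTop.1 hfreq K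
  obtain ⟨i, hi, hne⟩ := hK (2 * n) (by lia)
  exact hne (if_pos ⟨n, hnN, hi⟩)

/-! ### Cylinders in the Cohen algebra -/

/-- The element of the Cohen algebra given by an open set. -/
noncomputable def openClass (U : Set Cantor) (hU : IsOpen U) : CohenAlgebra :=
  mk meagreIdeal ⟨U, hU.measurableSet⟩

/-- The element of the Cohen algebra given by the cylinder of all sequences that agree with `z`
below `m`. -/
noncomputable def cylinderClass (z : Cantor) (m : ℕ) : CohenAlgebra :=
  openClass (cylinder z m) (isOpen_cylinder _ z m)

theorem openClass_le_openClass {U V : Set Cantor} {hU : IsOpen U} {hV : IsOpen V} :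
    openClass U hU ≤ openClass V hV ↔ IsMeagre (U \ V) := Iff.rfl

theorem disjoint_of_openClass_inf_eq_bot {U V : Set Cantor} {hU : IsOpen U} {hV : IsOpen V}
    (h : openClass U hU ⊓ openClass V hV = ⊥) : Disjoint U V := by
  rw [disjoint_iff_inter_eq_empty]
  by_contra hne
  exact not_isMeagre_of_isOpen (hU.inter hV) (nonempty_iff_ne_empty.2 hne) (mk_eq_bot.1 h)

theorem openClass_inf_eq_bot_of_disjoint {U V : Set Cantor} {hU : IsOpen U} {hV : IsOpen V}
    (h : Disjoint U V) : openClass U hU ⊓ openClass V hV = ⊥ := by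
  refine mk_eq_bot.2 (?_ : IsMeagre (U ∩ V))
  rw [h.inter_eq]
  exact IsMeagre.empty

theorem openClass_mono {V W : Set Cantor} {hV : IsOpen V} {hW : IsOpen W} (h : V ⊆ W) :
    openClass V hV ≤ openClass W hW := by
  rw [openClass_le_openClass, sdiff_eq_empty.2 h]
  exact IsMeagre.empty

theorem cylinderClass_ne_bot (z : Cantor) (m : ℕ) : cylinderClass z m ≠ ⊥ := fun h =>
  not_isMeagre_of_isOpen (isOpen_cylinder _ z m) ⟨z, self_mem_cylinder z m⟩ (mk_eq_bot.1 h)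

theorem mem_cylinder_of_cylinderClass_le {y z : Cantor} {m n : ℕ}
    (h : cylinderClass y n ≤ cylinderClass z m) : y ∈ cylinder z m := by
  by_contra hy
  have hcl : IsClosed (cylinder z m) := by
    rw [← isOpen_compl_iff]
    refine isOpen_of_forall_cylinder_subset fun w hw => ⟨m, fun v hv hvz => hw ?_⟩
    rw [← mem_cylinder_iff_eq.1 hvz, mem_cylinder_comm]
    exact hv
  exact not_isMeagre_of_isOpen ((isOpen_cylinder _ y n).sdiff hcl) ⟨y, self_mem_cylinder y n, hy⟩
    (openClass_le_openClass.1 h)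

/-- Cylinders are dense in the Cohen algebra, because Borel sets have the Baire property. -/
theorem exists_cylinderClass_le {c : CohenAlgebra} (hc : c ≠ ⊥) :
    ∃ z m, cylinderClass z m ≤ c := by
  obtain ⟨⟨S, hS⟩, rfl⟩ := Quotient.exists_rep c
  change mk meagreIdeal ⟨S, hS⟩ ≠ ⊥ at hc
  have hS' : ¬ IsMeagre S := fun h => hc (mk_eq_bot.2 h)
  obtain ⟨U, hU, hSU⟩ := hS.residualEq_isOpen
  have hU' : U.Nonempty := by
    by_contra hne
    rw [not_nonempty_iff_eq_empty] at hne
    subst hne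
    refine hS' ?_
    filter_upwards [hSU] with x hx hxS
    exact (hx.mp hxS : x ∈ (∅ : Set Cantor))
  obtain ⟨z, hz⟩ := hU'
  obtain ⟨m, hm⟩ := exists_cylinder_subset hU hz
  refine ⟨z, m, (?_ : IsMeagre (cylinder z m \ S))⟩
  filter_upwards [hSU] with x hx hxS
  exact hxS.2 (hx.mpr (hm hxS.1))

/-- The sets that decide `c`: every open subset is below `c`, or every open subset is disjoint
from `c`. -/
def decidingFamily (c : CohenAlgebra) : Set (Set Cantor) :=
  {W | (∀ V hV, V ⊆ W → openClass V hV ≤ c) ∨ ∀ V hV, V ⊆ W → openClass V hV ⊓ c = ⊥}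

theorem isDenseFamily_decidingFamily (c : CohenAlgebra) : IsDenseFamily (decidingFamily c) where
  isLowerSet W W' h hW := hW.imp (fun hW V hV hVW => hW V hV (hVW.trans h))
    fun hW V hV hVW => hW V hV (hVW.trans h)
  exists_cylinder_mem x m := by
    by_cases hc : cylinderClass x m ⊓ c = ⊥
    · refine ⟨x, self_mem_cylinder x m, m, Or.inr fun V hV hVW => le_bot_iff.1 ?_⟩
      exact (inf_le_inf_right c (openClass_mono hVW)).trans hc.le
    · obtain ⟨z, n, h⟩ := exists_cylinderClass_le hc
      exact ⟨z, mem_cylinder_of_cylinderClass_le (h.trans inf_le_left), n,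
        Or.inl fun V hV hVW => (openClass_mono hVW).trans (h.trans inf_le_right)⟩

theorem cylinderClass_le_or_inf_eq_bot {c : CohenAlgebra} {z : Cantor} {m : ℕ}
    (h : cylinder z m ∈ decidingFamily c) :
    cylinderClass z m ≤ c ∨ cylinderClass z m ⊓ c = ⊥ :=
  h.imp (fun h => h _ _ subset_rfl) fun h => h _ _ subset_rfl

/-! ### Reduced powers -/

namespace ReducedPower

variable {B : Type*} [BooleanAlgebra B]

theorem mk_le_mk_iff {f g : ℕ → B} :
    mk (seqFinIdeal B) f ≤ mk (seqFinIdeal B) g ↔ ∀ᶠ n in atTop, f n ≤ g n := by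
  rw [← Nat.cofinite_eq_atTop, eventually_cofinite, mk_le_mk]
  exact iff_of_eq (congrArg Set.Finite (Set.ext fun n => not_congr sdiff_eq_bot_iff))

theorem mk_inf_mk_eq_bot_iff {f g : ℕ → B} :
    mk (seqFinIdeal B) f ⊓ mk (seqFinIdeal B) g = ⊥ ↔ ∀ᶠ n in atTop, f n ⊓ g n = ⊥ := by
  rw [← Nat.cofinite_eq_atTop, eventually_cofinite, mk_inf_mk, mk_eq_bot]
  rfl

theorem mk_ne_bot_iff {f : ℕ → B} : mk (seqFinIdeal B) f ≠ ⊥ ↔ {n | f n ≠ ⊥}.Infinite :=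
  not_congr mk_eq_bot

end ReducedPower

namespace PowFin

theorem mk_le_mk_iff {X Y : Set ℕ} :
    mk finIdeal X ≤ mk finIdeal Y ↔ ∀ᶠ n in atTop, n ∈ X → n ∈ Y := by
  rw [← Nat.cofinite_eq_atTop, eventually_cofinite, mk_le_mk]
  simp only [Classical.not_imp]
  rfl

theorem mk_inf_mk_eq_bot_iff {X Y : Set ℕ} :
    mk finIdeal X ⊓ mk finIdeal Y = ⊥ ↔ ∀ᶠ n in atTop, n ∈ X → n ∉ Y := by
  rw [← Nat.cofinite_eq_atTop, eventually_cofinite, mk_inf_mk, mk_eq_bot]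
  simp only [Classical.not_imp, not_not]
  rfl

theorem mk_ne_bot_iff {X : Set ℕ} : mk finIdeal X ≠ ⊥ ↔ X.Infinite :=
  not_congr mk_eq_bot

end PowFin

open Classical in
/-- Reaping `𝒫(ω)/fin` is Tukey below reaping any reduced power: subsets of `ω` are identified
with their characteristic sequences. -/
theorem exists_tukey_powFin_reducedPower (B : Type) [BooleanAlgebra B] [Nontrivial B] :
    ∃ (φ : (reapingRelation PowFin).Neg → (reapingRelation (ReducedPower B)).Neg)
      (ψ : (reapingRelation (ReducedPower B)).Pos → (reapingRelation PowFin).Pos),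
      ∀ x y, (reapingRelation (ReducedPower B)).Rel (φ x) y →
        (reapingRelation PowFin).Rel x (ψ y) := by
  have hX : ∀ x : PowFin, ∃ X : Set ℕ, mk finIdeal X = x := Quotient.exists_rep
  have hf : ∀ y : ReducedPower B, ∃ f : ℕ → B, mk (seqFinIdeal B) f = y := Quotient.exists_rep
  choose X hX using hX
  choose f hf using hf
  refine ⟨fun x => mk (seqFinIdeal B) fun n => if n ∈ X x then ⊤ else ⊥,
    fun y => ⟨mk finIdeal {n | f y.1 n ≠ ⊥},
      PowFin.mk_ne_bot_iff.2 (ReducedPower.mk_ne_bot_iff.1 ((hf y.1).symm ▸ y.2))⟩, ?_⟩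
  intro (x : PowFin) y h
  refine Or.imp (fun h => ?_) (fun h => ?_) h
  · rw [← hf y.1, ReducedPower.mk_le_mk_iff] at h
    rw [← hX x, PowFin.mk_le_mk_iff]
    filter_upwards [h] with n hn hne
    by_contra hnX
    rw [if_neg hnX] at hn
    exact hne (le_bot_iff.1 hn)
  · rw [← hf y.1, ReducedPower.mk_inf_mk_eq_bot_iff] at h
    rw [← hX x, PowFin.mk_inf_mk_eq_bot_iff]
    filter_upwards [h] with n hn hne hnX
    rw [if_pos hnX, inf_top_eq] at hn
    exact hne hn

/-! ### Reaping the reduced power of the Cohen algebra -/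

open Classical in
/-- A sequence in the Cohen algebra is reaped by first covering a meagre set, which yields a
sequence of cylinders deciding almost all of its entries, and then reaping the set of those `n`
where the decision is positive. -/
theorem exists_tukey_reducedPower_meagre_powFin :
    ∃ (φ : (reapingRelation (ReducedPower CohenAlgebra)).Neg → meagreRelation.Neg)
      (χ : (reapingRelation (ReducedPower CohenAlgebra)).Neg → meagreRelation.Pos →
        (reapingRelation PowFin).Neg)
      (ψ : meagreRelation.Pos → (reapingRelation PowFin).Pos →
        (reapingRelation (ReducedPower CohenAlgebra)).Pos),
      ∀ b y z, meagreRelation.Rel (φ b) y → (reapingRelation PowFin).Rel (χ b y) z →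
        (reapingRelation (ReducedPower CohenAlgebra)).Rel b (ψ y z) := by
  have hf : ∀ b : ReducedPower CohenAlgebra, ∃ f : ℕ → CohenAlgebra,
    mk (seqFinIdeal _) f = b := Quotient.exists_rep
  have hR : ∀ z : PowFin, ∃ R : Set ℕ, mk finIdeal R = z := Quotient.exists_rep
  choose f hf using hf
  choose R hR using hR
  choose x' l' hl' hD using fun b =>
    IsDenseFamily.exists_chopped fun i => isDenseFamily_decidingFamily (f b i)
  choose x l hl hY using fun Y : {Y : Set Cantor // IsMeagre Y} => Y.2.exists_subset_matchFinite
  let c : {Y : Set Cantor // IsMeagre Y} → ℕ → CohenAlgebra := fun Y n =>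
    cylinderClass (x Y) (l Y (2 * n + 1))
  refine ⟨fun b => ⟨matchFinite (x' b) (l' b), isMeagre_avoidSet (fun _ => (hl' b).le_apply) _ _⟩,
    fun b Y => mk finIdeal {n | c Y n ≤ f b n},
    fun Y z => ⟨mk (seqFinIdeal _) fun n => if n ∈ R z.1 then c Y n else ⊥, ?_⟩, ?_⟩
  · rw [ReducedPower.mk_ne_bot_iff]
    refine (PowFin.mk_ne_bot_iff.1 ((hR z.1).symm ▸ z.2)).mono fun n hn => ?_
    simp only [mem_ofPred_eq, if_pos hn]
    exact cylinderClass_ne_bot _ _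
  · intro b Y z hbY hz
    have hdec : ∀ᶠ n in atTop, c Y n ≤ f b n ∨ c Y n ⊓ f b n = ⊥ := by
      filter_upwards [eventually_exists_block_of_matchFinite_subset (hl Y) (hl' b)
        (hbY.trans (hY Y))] with n ⟨k, h₁, h₂, h₃⟩
      refine cylinderClass_le_or_inf_eq_bot ?_
      refine (isDenseFamily_decidingFamily _).isLowerSet (cylinder_anti _ h₂) (hD b k _ h₃ n ?_)
      exact (Nat.le_mul_of_pos_left n two_pos).trans ((hl Y).le_apply.trans h₁)
    refine Or.imp (fun hz => ?_) (fun hz => ?_) hz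
    · rw [← hR z.1, PowFin.mk_le_mk_iff] at hz
      rw [← hf b, ReducedPower.mk_le_mk_iff]
      filter_upwards [hz] with n hn
      split_ifs with hnR
      exacts [hn hnR, bot_le]
    · rw [← hR z.1, PowFin.mk_inf_mk_eq_bot_iff] at hz
      rw [← hf b, ReducedPower.mk_inf_mk_eq_bot_iff]
      filter_upwards [hz, hdec] with n hn hd
      split_ifs with hnR
      exacts [hd.resolve_left (hn hnR), bot_inf_eq _]

/-- The sequences that match `x` on a block with index at least `n` and whose value right after the
first such block is `e`. For the two values of `e`, these are disjoint open sets with dense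
union. -/
def firstMatch (x : Cantor) (l : ℕ → ℕ) (n : ℕ) (e : Bool) : Set Cantor :=
  {y | ∃ k ≥ n, (∀ i ∈ Ico (l k) (l (k + 1)), y i = x i) ∧
    (∀ k' ≥ n, k' < k → ∃ i ∈ Ico (l k') (l (k' + 1)), y i ≠ x i) ∧ y (l (k + 1)) = e}

theorem isOpen_firstMatch (x : Cantor) {l : ℕ → ℕ} (hl : StrictMono l) (n : ℕ) (e : Bool) :
    IsOpen (firstMatch x l n e) := by
  refine isOpen_of_forall_cylinder_subset ?_
  rintro y ⟨k, hk, h₁, h₂, h₃⟩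
  refine ⟨l (k + 1) + 1, fun z hz => ⟨k, hk, fun i hi => ?_, fun k' hk' hlt => ?_, ?_⟩⟩
  · rw [mem_cylinder_iff.1 hz i (hi.2.trans (Nat.lt_succ_self _)), h₁ i hi]
  · obtain ⟨i, hi, hne⟩ := h₂ k' hk' hlt
    have : l (k' + 1) ≤ l (k + 1) := hl.monotone (by lia)
    refine ⟨i, hi, ?_⟩
    rwa [mem_cylinder_iff.1 hz i (by have := hi.2; lia)]
  · rw [mem_cylinder_iff.1 hz _ (Nat.lt_succ_self _), h₃]

theorem disjoint_firstMatch (x : Cantor) (l : ℕ → ℕ) (n : ℕ) :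
    Disjoint (firstMatch x l n true) (firstMatch x l n false) := by
  rw [disjoint_left]
  rintro y ⟨k, hk, h₁, h₂, h₃⟩ ⟨p, hp, h₄, h₅, h₆⟩
  rcases lt_trichotomy k p with h | rfl | h
  · obtain ⟨i, hi, hne⟩ := h₅ k hk h
    exact hne (h₁ i hi)
  · rw [h₃] at h₆
    exact Bool.noConfusion h₆
  · obtain ⟨i, hi, hne⟩ := h₂ p hp h
    exact hne (h₄ i hi)

/-- If no block of `x` from `n` on occurs in `z` below `m`, then `z` restricted to `m` can be
extended so that the first such block is followed by `e`. -/
theorem exists_block_of_disjoint_firstMatch {x z : Cantor} {l : ℕ → ℕ} (hl : StrictMono l)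
    {n m : ℕ} {e : Bool} (h : Disjoint (cylinder z m) (firstMatch x l n e)) :
    ∃ k ≥ n, l (k + 1) ≤ m ∧ ∀ i ∈ Ico (l k) (l (k + 1)), z i = x i := by
  by_contra! hno
  -- Continue `z` by values different from those of `x` up to the block with index `p`, match `x`
  -- there, and take the value `e` afterwards.
  let p := max n m
  have hp : m ≤ l p := (le_max_right n m).trans hl.le_apply
  have hpp : l p < l (p + 1) := hl p.lt_succ_self
  let y : Cantor := fun i => if i < m then z i else if i < l p then !x i else
    if i < l (p + 1) then x i else e
  refine disjoint_left.1 h (show y ∈ _ from mem_cylinder_iff.2 fun i hi => if_pos hi)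
    ⟨p, le_max_left _ _, fun i hi => ?_, fun k hk hkp => ?_, ?_⟩
  · have := hi.1
    have := hi.2
    simp only [y]
    rw [if_neg (by lia), if_neg (by lia), if_pos (by lia)]
  · have hkl : l k < l (k + 1) := hl k.lt_succ_self
    have hkp' : l (k + 1) ≤ l p := hl.monotone hkp
    by_cases hkm : l (k + 1) ≤ m
    · obtain ⟨i, hi, hne⟩ := hno k hk hkm
      refine ⟨i, hi, ?_⟩
      simp only [y]
      rwa [if_pos (hi.2.trans_le hkm)]
    · refine ⟨l (k + 1) - 1, ⟨by lia, by lia⟩, ?_⟩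
      simp only [y]
      rw [if_neg (by lia), if_pos (by lia)]
      exact Bool.not_ne_self _
  · simp only [y]
    rw [if_neg (by lia), if_neg (by lia), if_neg (lt_irrefl _)]

theorem exists_block_of_cylinderClass_decides {x z : Cantor} {l : ℕ → ℕ} (hl : StrictMono l)
    {n m : ℕ} (h : cylinderClass z m ≤ openClass _ (isOpen_firstMatch x hl n true) ∨
      cylinderClass z m ⊓ openClass _ (isOpen_firstMatch x hl n true) = ⊥) :
    ∃ k ≥ n, l (k + 1) ≤ m ∧ ∀ i ∈ Ico (l k) (l (k + 1)), z i = x i := by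
  rcases h with h | h
  · refine exists_block_of_disjoint_firstMatch hl (e := false) (disjoint_of_openClass_inf_eq_bot
      (hU := isOpen_cylinder _ z m) (hV := isOpen_firstMatch x hl n false) (le_bot_iff.1 ?_))
    exact (inf_le_inf_right _ h).trans
      (openClass_inf_eq_bot_of_disjoint (disjoint_firstMatch x l n)).le
  · exact exists_block_of_disjoint_firstMatch hl (disjoint_of_openClass_inf_eq_bot h)

theorem ReducedPower.exists_strictMono_cylinderClass_le {f : ℕ → CohenAlgebra}
    (hf : {n | f n ≠ ⊥}.Infinite) : ∃ (a : ℕ → ℕ) (z : ℕ → Cantor) (m : ℕ → ℕ),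
      StrictMono a ∧ ∀ n, cylinderClass (z n) (m n) ≤ f (a n) := by
  classical
  choose z m h using fun n => exists_cylinderClass_le (Nat.nth_mem_of_infinite hf n)
  exact ⟨_, z, m, Nat.nth_strictMono hf, h⟩

/-- The meagre ideal is Tukey below reaping the reduced power of the Cohen algebra. -/
theorem exists_tukey_meagre_reducedPower :
    ∃ (φ : meagreRelation.Neg → (reapingRelation (ReducedPower CohenAlgebra)).Neg)
      (ψ : (reapingRelation (ReducedPower CohenAlgebra)).Pos → meagreRelation.Pos),
      ∀ Y r, (reapingRelation (ReducedPower CohenAlgebra)).Rel (φ Y) r →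
        meagreRelation.Rel Y (ψ r) := by
  have hf : ∀ b : ReducedPower CohenAlgebra, ∃ f : ℕ → CohenAlgebra,
    mk (seqFinIdeal _) f = b := Quotient.exists_rep
  choose f hf using hf
  choose x l hl hY using fun Y : {Y : Set Cantor // IsMeagre Y} => Y.2.exists_subset_matchFinite
  choose a z m ha hle using fun r : {r : ReducedPower CohenAlgebra // r ≠ ⊥} =>
    ReducedPower.exists_strictMono_cylinderClass_le
      (ReducedPower.mk_ne_bot_iff.1 ((hf r.1).symm ▸ r.2))
  refine ⟨fun Y => BAQuotient.mk (seqFinIdeal CohenAlgebra) fun n => openClass _ (isOpen_firstMatch (x Y) (hl Y) n true),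
    fun r => ⟨avoidSet id (m r) (z r), isMeagre_avoidSet (fun _ => le_rfl) _ _⟩, ?_⟩
  intro Y r h
  have hev : ∀ᶠ n in atTop, ∃ k ≥ a r n, l Y (k + 1) ≤ m r n ∧
      ∀ i ∈ Ico (l Y k) (l Y (k + 1)), z r n i = x Y i := by
    rcases h with h | h
    · rw [← hf r.1, ReducedPower.mk_le_mk_iff] at h
      filter_upwards [(ha r).tendsto_atTop.eventually h] with n hn
      exact exists_block_of_cylinderClass_decides (hl Y) (Or.inl ((hle r n).trans hn))
    · rw [← hf r.1, ReducedPower.mk_inf_mk_eq_bot_iff] at h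
      filter_upwards [(ha r).tendsto_atTop.eventually h] with n hn
      exact exists_block_of_cylinderClass_decides (hl Y)
        (Or.inr (le_bot_iff.1 ((inf_le_inf_right _ (hle r n)).trans hn.le)))
  intro y hy
  obtain ⟨K, hK⟩ := eventually_atTop.1 (hY Y hy)
  change ∀ᶠ n in atTop, _
  filter_upwards [hev, eventually_ge_atTop K] with n ⟨k, hk, hkm, hzx⟩ hn
  have hnk : n ≤ k := (ha r).le_apply.trans hk
  obtain ⟨i, hi, hne⟩ := hK k (hn.trans hnk)
  refine ⟨i, ⟨hnk.trans ((hl Y).le_apply.trans hi.1), hi.2.trans_le hkm⟩, ?_⟩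
  rwa [hzx i hi]

end

open RelationalSystem in
theorem mainTheorem2 :
    reapingNumber (ReducedPower CohenAlgebra) = reapingNumber PowFin + cofMeagre ∧
      splittingNumber (ReducedPower CohenAlgebra) = min (splittingNumber PowFin) addMeagre := by
  obtain ⟨φ₁, ψ₁, h₁⟩ := exists_tukey_powFin_reducedPower CohenAlgebra
  obtain ⟨φ₂, ψ₂, h₂⟩ := exists_tukey_meagre_reducedPower
  obtain ⟨φ₃, χ₃, ψ₃, h₃⟩ := exists_tukey_reducedPower_meagre_powFin
  have hr := (isLeast_reapingNumber (ReducedPower CohenAlgebra)).nonempty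
  have hrω := (isLeast_reapingNumber PowFin).nonempty
  have hs := (isLeast_splittingNumber _ (reducedPower_atomless CohenAlgebra)).nonempty
  have hsω := (isLeast_splittingNumber _ powFin_atomless).nonempty
  have hcof := meagreRelation_dominatingCards ▸ isLeast_cofMeagre.nonempty
  have hadd := meagreRelation_unboundedCards ▸ isLeast_addMeagre.nonempty
  have r₁ : reapingNumber PowFin ≤ reapingNumber (ReducedPower CohenAlgebra) :=
    dominatingNumber_le_of_tukey φ₁ ψ₁ h₁ hr
  have r₂ : cofMeagre ≤ reapingNumber (ReducedPower CohenAlgebra) :=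
    meagreRelation_dominatingNumber ▸ dominatingNumber_le_of_tukey φ₂ ψ₂ h₂ hr
  have r₃ : reapingNumber (ReducedPower CohenAlgebra) ≤ cofMeagre * reapingNumber PowFin :=
    meagreRelation_dominatingNumber ▸ dominatingNumber_le_mul φ₃ χ₃ ψ₃ h₃ hcof hrω
  have s₁ : splittingNumber (ReducedPower CohenAlgebra) ≤ splittingNumber PowFin :=
    boundingNumber_le_of_tukey φ₁ ψ₁ h₁ hsω
  have s₂ : splittingNumber (ReducedPower CohenAlgebra) ≤ addMeagre :=
    meagreRelation_boundingNumber ▸ boundingNumber_le_of_tukey φ₂ ψ₂ h₂ hadd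
  have s₃ : min addMeagre (splittingNumber PowFin) ≤
      splittingNumber (ReducedPower CohenAlgebra) :=
    meagreRelation_boundingNumber ▸ min_boundingNumber_le φ₃ χ₃ ψ₃ h₃ hs
  constructor
  · refine le_antisymm (r₃.trans ?_) (add_le_of_le (aleph0_le_cofMeagre.trans r₂) r₁ r₂)
    have hle : cofMeagre ≤ reapingNumber PowFin + cofMeagre := self_le_add_left _ _
    calc cofMeagre * reapingNumber PowFin
        ≤ (reapingNumber PowFin + cofMeagre) * (reapingNumber PowFin + cofMeagre) :=
          mul_le_mul' hle (self_le_add_right _ _)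
      _ = reapingNumber PowFin + cofMeagre := mul_eq_self (aleph0_le_cofMeagre.trans hle)
  · exact le_antisymm (le_min s₁ s₂) (min_comm addMeagre _ ▸ s₃)
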